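/- Let $p$ be a prime, let $D$ be a division ring that is finite-dimensional over its center $C$, where $C$ has characteristic $p$, and let $\delta$ be a derivation of $D$. Put $F=\{a\in C:\delta(a)=0\}$, a field. Let $R=D[t;\delta]$ be the ring of differential polynomials $\sum a_it^i$ ($a_i\in D$) with $ta=at+\delta(a)$ for $a\in D$. Call a polynomial over $F$ a $p$-polynomial if it is an $F$-linear combination of the monomials $x^{p^i}$, $i\ge 0$. Assume that $\delta$ is algebraic with minimum $p$-polynomial $g$ of degree $p^e$, that is, $g=x^{p^e}+\gamma_1x^{p^{e-1}}+\dots+\gamma_ex\in F[x]$ is the monic $p$-polynomial of least degree such that $g(\delta)$ is an inner derivation of $D$. Let $c\in D$ satisfy $g(\delta)(a)=ca-ac$ for all $a\in D$ and $\delta(c)=0$ (so that $R$ has center $F[g(t)-c]$). For $f\in R$ let $\mathcal E(f)=\{q\in R: fq\in Rf\}/Rf$ be its eigenring, an $F$-algebra; $f$ is called a generalised A-polynomial if $\mathcal E(f)$ is a (finite-dimensional) central simple algebra over $F$. Let $f\in R$ and let $\hat h\in F[x]$ be the monic polynomial such that $h(t)=\hat h(g(t)-c)$ is the minimal central left multiple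 of $f$, i.e. a nonzero element of least degree among the central elements of $R$ that lie in $Rf$. Suppose that $\hat h$ is irreducible in $F[x]$. Then $f$ is a generalised A-polynomial if and only if $f$ right divides $g(t)-(b+c)$ for some $b\in F$ (that is, $g(t)-(b+c)\in Rf$). In particular, if $f$ is a generalised A-polynomial, then $\deg f\le p^e$. -/

import Mathlib

open Polynomial

noncomputable section

/-- A derivation of a (not necessarily commutative) ring: an additive map with
`δ (x * y) = x * δ y + δ x * y`. -/
structure RingDerivation (D : Type*) [Ring D] extends D →+ D where
  leibniz' : ∀ x y : D, toFun (x * y) = x * toFun y + toFun x * y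

namespace RingDerivation

section Ring

variable {D : Type*} [Ring D]

instance : FunLike (RingDerivation D) D D where
  coe δ := δ.toFun
  coe_injective δ₁ δ₂ h := by
    cases δ₁; cases δ₂; congr; exact DFunLike.coe_injective h

instance : AddMonoidHomClass (RingDerivation D) D D where
  map_add δ := δ.map_add'
  map_zero δ := δ.map_zero'

theorem leibniz (δ : RingDerivation D) (x y : D) : δ (x * y) = x * δ y + δ x * y :=
  δ.leibniz' x y

theorem map_one (δ : RingDerivation D) : δ 1 = 0 := by
  have h := δ.leibniz 1 1
  simpa using h

end Ring

variable {D : Type*} [DivisionRing D]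

/-- The field `F = C ∩ Const(δ)` of the elements of the center `C` of `D` that are
annihilated by `δ`. -/
def constField (δ : RingDerivation D) : Subfield D where
  carrier := {a | a ∈ Subring.center D ∧ δ a = 0}
  mul_mem' := by
    rintro a b ⟨ha, ha'⟩ ⟨hb, hb'⟩
    exact ⟨mul_mem ha hb, by rw [leibniz, ha', hb', mul_zero, zero_mul, add_zero]⟩
  one_mem' := ⟨one_mem _, δ.map_one⟩
  add_mem' := by
    rintro a b ⟨ha, ha'⟩ ⟨hb, hb'⟩
    exact ⟨add_mem ha hb, by rw [map_add, ha', hb', add_zero]⟩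
  zero_mem' := ⟨zero_mem _, map_zero δ⟩
  neg_mem' := by
    rintro a ⟨ha, ha'⟩
    exact ⟨neg_mem ha, by rw [map_neg, ha', neg_zero]⟩
  inv_mem' := by
    rintro a ⟨ha, ha'⟩
    refine ⟨Set.inv_mem_center ha, ?_⟩
    by_cases h0 : a = 0
    · simp [h0]
    · have h := δ.leibniz a a⁻¹
      rw [mul_inv_cancel₀ h0, δ.map_one, ha', zero_mul, add_zero] at h
      exact (mul_eq_zero.mp h.symm).resolve_left h0

theorem mem_constField (δ : RingDerivation D) (a : D) :
    a ∈ δ.constField ↔ a ∈ Subring.center D ∧ δ a = 0 := Iff.rfl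

theorem constField_comm (δ : RingDerivation D) (a : δ.constField) (x : D) :
    (a : D) * x = x * a := (Subring.mem_center_iff.mp a.2.1 x).symm

instance (δ : RingDerivation D) : Field δ.constField :=
  { (inferInstance : DivisionRing δ.constField) with
    mul_comm := fun a b => Subtype.ext (δ.constField_comm a b) }

/-- The derivation `δ` as an `F`-linear endomorphism of `D`. -/
def toEnd (δ : RingDerivation D) : Module.End δ.constField D where
  toFun := δ
  map_add' := map_add δ
  map_smul' a x := by
    change δ ((a : D) * x) = (a : D) * δ x
    rw [leibniz, a.2.2, zero_mul, add_zero]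

end RingDerivation

/-- A `p`-polynomial: a linear combination of the powers `x ^ (p ^ i)`, `i = 0, 1, 2, …`. -/
def IsPPolynomial {k : Type*} [Semiring k] (p : ℕ) (g : k[X]) : Prop :=
  ∀ n ∈ g.support, ∃ i : ℕ, n = p ^ i

/-- `φ` is the inner derivation `δ_c`, where `δ_c(a) = [c, a] = c * a - a * c`. -/
def IsInnerBy {D : Type*} [Ring D] (φ : D → D) (c : D) : Prop :=
  ∀ a : D, φ a = c * a - a * c

/-- `g` is the minimum `p`-polynomial of `δ`: the monic `p`-polynomial over `F = C ∩ Const(δ)`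
of least degree such that `g(δ)` is an inner derivation of `D`. -/
def IsMinPPolynomial {D : Type*} [DivisionRing D] (p : ℕ) (δ : RingDerivation D)
    (g : (δ.constField)[X]) : Prop :=
  g.Monic ∧ IsPPolynomial p g ∧ (∃ c : D, IsInnerBy (aeval δ.toEnd g) c) ∧
    ∀ g' : (δ.constField)[X], g'.Monic → IsPPolynomial p g' →
      (∃ c : D, IsInnerBy (aeval δ.toEnd g') c) → g.natDegree ≤ g'.natDegree

/-- The ring `R = D[t; δ]` of differential polynomials `∑ aᵢ tⁱ` (coefficients on the left).
The additive group is that of the ordinary polynomials, the multiplication is the one with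
`t * a = a * t + δ a`, defined below. -/
def DiffPoly {D : Type*} [Ring D] (_δ : RingDerivation D) : Type _ := D[X]

namespace DiffPoly

section Ring

variable {D : Type*} [Ring D] (δ : RingDerivation D)

instance : AddCommGroup (DiffPoly δ) := inferInstanceAs (AddCommGroup D[X])

/-- The coefficientwise action of `δ`: `∑ bⱼ tʲ ↦ ∑ δ(bⱼ) tʲ`. -/
def mapCoeff : D[X] →+ D[X] :=
  AddMonoidHom.mk' (fun q => q.sum fun j b => Polynomial.monomial j (δ b)) fun p q =>
    Polynomial.sum_add_index p q _ (by simp) (by simp)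

/-- Left multiplication by `t`: `∑ bⱼ tʲ ↦ ∑ (bⱼ tʲ⁺¹ + δ(bⱼ) tʲ)`. -/
def tMul : AddMonoid.End D[X] := AddMonoidHom.mulRight (Polynomial.X : D[X]) + mapCoeff δ

/-- Left multiplication by `a` in `D`: `∑ bⱼ tʲ ↦ ∑ a bⱼ tʲ`. -/
def cMul : D →+* AddMonoid.End D[X] := Module.toAddMonoidEnd D D[X]

/-- Left multiplication by `p = ∑ aᵢ tⁱ`: the operator `∑ aᵢ ∘ tⁱ`. -/
def lMul : D[X] →+ AddMonoid.End D[X] :=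
  AddMonoidHom.mk' (fun p => p.sum fun i a => cMul a * tMul δ ^ i)
    fun p q => Polynomial.sum_add_index p q _ (by simp) (by simp [add_mul])

theorem end_mul_apply (φ ψ : AddMonoid.End D[X]) (q : D[X]) : (φ * ψ) q = φ (ψ q) := rfl

theorem end_add_apply (φ ψ : AddMonoid.End D[X]) (q : D[X]) : (φ + ψ) q = φ q + ψ q := rfl

theorem cMul_apply (a : D) (q : D[X]) : cMul a q = a • q := rfl

theorem mapCoeff_monomial (n : ℕ) (a : D) :
    mapCoeff δ (Polynomial.monomial n a) = Polynomial.monomial n (δ a) :=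
  Polynomial.sum_monomial_index a (fun j b => Polynomial.monomial j (δ b)) (by simp)

theorem tMul_monomial (n : ℕ) (a : D) :
    tMul δ (Polynomial.monomial n a) =
      Polynomial.monomial (n + 1) a + Polynomial.monomial n (δ a) := by
  change Polynomial.monomial n a * Polynomial.X + mapCoeff δ (Polynomial.monomial n a) = _
  rw [mapCoeff_monomial, Polynomial.monomial_mul_X]

theorem tMul_pow_one (n : ℕ) : (tMul δ ^ n) (1 : D[X]) = Polynomial.monomial n 1 := by
  induction n with
  | zero => simp
  | succ n ih => rw [pow_succ', end_mul_apply, ih, tMul_monomial, δ.map_one, map_zero, add_zero]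

theorem lMul_monomial (n : ℕ) (a : D) :
    lMul δ (Polynomial.monomial n a) = cMul a * tMul δ ^ n :=
  Polynomial.sum_monomial_index a
    (fun i a => cMul a * tMul δ ^ i) (by simp)

theorem tMul_mul_smul (a : D) :
    tMul δ * cMul a =
      cMul a * tMul δ + cMul (δ a) := by
  refine DFunLike.ext _ _ fun q => ?_
  induction q using Polynomial.induction_on' with
  | add p q hp hq => rw [map_add, hp, hq, map_add]
  | monomial n b =>
    simp only [end_add_apply, end_mul_apply, cMul_apply, tMul_monomial,
      Polynomial.smul_monomial, smul_eq_mul, δ.leibniz, map_add, add_assoc]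

theorem lMul_smul (a : D) (q : D[X]) :
    lMul δ (a • q) = cMul a * lMul δ q := by
  induction q using Polynomial.induction_on' with
  | add p q hp hq => rw [smul_add, map_add, hp, hq, map_add, mul_add]
  | monomial n b => simp [Polynomial.smul_monomial, lMul_monomial, mul_assoc]

theorem lMul_tMul (q : D[X]) : lMul δ (tMul δ q) = tMul δ * lMul δ q := by
  induction q using Polynomial.induction_on' with
  | add p q hp hq => rw [map_add, map_add, hp, hq, map_add, mul_add]
  | monomial n b =>
    rw [tMul_monomial, map_add, lMul_monomial, lMul_monomial, lMul_monomial, ← mul_assoc,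
      tMul_mul_smul, add_mul, pow_succ', mul_assoc]

theorem lMul_lMul (p q : D[X]) : lMul δ (lMul δ p q) = lMul δ p * lMul δ q := by
  induction p using Polynomial.induction_on' with
  | add p₁ p₂ h₁ h₂ => rw [map_add, end_add_apply, map_add, h₁, h₂, add_mul]
  | monomial n a =>
    have h : ∀ r : D[X], lMul δ ((tMul δ ^ n) r) = tMul δ ^ n * lMul δ r := by
      induction n with
      | zero => intro r; simp
      | succ n ih =>
        intro r
        rw [pow_succ', end_mul_apply, lMul_tMul, ih, mul_assoc]
    rw [lMul_monomial, end_mul_apply, cMul_apply, lMul_smul, h,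
      mul_assoc]

theorem lMul_one : lMul δ 1 = 1 := by
  rw [← Polynomial.monomial_zero_one, lMul_monomial]; simp

theorem lMul_apply_one (p : D[X]) : lMul δ p 1 = p := by
  induction p using Polynomial.induction_on' with
  | add p q hp hq => rw [map_add, end_add_apply, hp, hq]
  | monomial n a =>
    rw [lMul_monomial, end_mul_apply, tMul_pow_one, cMul_apply,
      Polynomial.smul_monomial, smul_eq_mul, mul_one]

instance : Ring (DiffPoly δ) :=
  { (inferInstance : AddCommGroup (DiffPoly δ)) with
    mul := fun p q => lMul δ p q
    one := (1 : D[X])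
    mul_assoc := fun p q r => congrArg (fun φ : AddMonoid.End D[X] => φ r) (lMul_lMul δ p q)
    one_mul := fun p => congrArg (fun φ : AddMonoid.End D[X] => φ p) (lMul_one δ)
    mul_one := lMul_apply_one δ
    zero_mul := fun p => congrArg (fun φ : AddMonoid.End D[X] => φ p) (map_zero (lMul δ))
    mul_zero := fun p => map_zero (lMul δ p)
    left_distrib := fun p q r => map_add (lMul δ p) q r
    right_distrib := fun p q r =>
      congrArg (fun φ : AddMonoid.End D[X] => φ r) (map_add (lMul δ) p q) }

variable {δ}

/-- The degree, with value `⊥` (that is, `-∞`) at `0`. -/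
def degree (f : DiffPoly δ) : WithBot ℕ := Polynomial.degree (R := D) f

variable (δ)

/-- The indeterminate `t`. -/
def t : DiffPoly δ := (Polynomial.X : D[X])

/-- The inclusion of `D` into `D[t; δ]` as the constant polynomials. -/
def C : D →+* DiffPoly δ where
  toFun a := (Polynomial.C a : D[X])
  map_one' := Polynomial.C_1
  map_zero' := Polynomial.C_0
  map_add' _ _ := Polynomial.C_add
  map_mul' a b := by
    change (Polynomial.C (a * b) : D[X]) = lMul δ (Polynomial.C a) (Polynomial.C b)
    rw [← Polynomial.monomial_zero_left, ← Polynomial.monomial_zero_left,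
      ← Polynomial.monomial_zero_left, lMul_monomial, pow_zero, mul_one,
      cMul_apply, Polynomial.smul_monomial, smul_eq_mul]

/-- The defining relation of `D[t; δ]`. -/
theorem t_mul_C (a : D) : t δ * C δ a = C δ a * t δ + C δ (δ a) := by
  change lMul δ Polynomial.X (Polynomial.C a) =
    lMul δ (Polynomial.C a) Polynomial.X + (Polynomial.C (δ a) : D[X])
  rw [← Polynomial.monomial_zero_left, ← Polynomial.monomial_zero_left,
    ← Polynomial.monomial_one_one_eq_X, lMul_monomial, lMul_monomial, pow_zero, pow_one, mul_one,
    end_mul_apply, tMul_monomial, cMul_apply,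
    cMul_apply, one_smul, Polynomial.smul_monomial, smul_eq_mul, mul_one]

theorem C_mul_t_pow (a : D) (n : ℕ) : C δ a * t δ ^ n = (Polynomial.monomial n a : D[X]) := by
  have h : ∀ n : ℕ, t δ ^ n = (Polynomial.monomial n 1 : D[X]) := by
    intro n
    induction n with
    | zero => rfl
    | succ n ih =>
      rw [pow_succ', ih]
      change lMul δ Polynomial.X (Polynomial.monomial n 1) = _
      rw [← Polynomial.monomial_one_one_eq_X, lMul_monomial, pow_one, end_mul_apply,
        tMul_monomial, δ.map_one, map_zero, add_zero, cMul_apply, one_smul]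
  rw [h]
  change lMul δ (Polynomial.C a) (Polynomial.monomial n 1) = _
  rw [← Polynomial.monomial_zero_left, lMul_monomial, pow_zero, mul_one,
    cMul_apply, Polynomial.smul_monomial, smul_eq_mul, mul_one]

end Ring

variable {D : Type*} [DivisionRing D] (δ : RingDerivation D)

/-- Every element of `F = C ∩ Const(δ)` is central in `D[t; δ]`. -/
theorem C_constField_comm (a : δ.constField) (q : DiffPoly δ) :
    C δ (a : D) * q = q * C δ (a : D) := by
  change lMul δ (Polynomial.C (a : D)) q = lMul δ q (Polynomial.C (a : D))
  have h : ∀ n : ℕ, (tMul δ ^ n) (Polynomial.monomial 0 (a : D)) =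
      Polynomial.monomial n (a : D) := by
    intro n
    induction n with
    | zero => rfl
    | succ n ih =>
      rw [pow_succ', end_mul_apply, ih, tMul_monomial, a.2.2, map_zero, add_zero]
  rw [← Polynomial.monomial_zero_left]
  refine Polynomial.induction_on' (motive := fun q : D[X] =>
    lMul δ (Polynomial.monomial 0 (a : D)) q = lMul δ q (Polynomial.monomial 0 (a : D)))
    q ?_ ?_
  · intro p q hp hq
    rw [map_add, map_add, end_add_apply, hp, hq]
  · intro n b
    rw [lMul_monomial, lMul_monomial, end_mul_apply, end_mul_apply, h, pow_zero,
      AddMonoid.End.coe_one, id_eq, cMul_apply, cMul_apply,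
      Polynomial.smul_monomial, Polynomial.smul_monomial, smul_eq_mul, smul_eq_mul,
      δ.constField_comm a b]

/-- `D[t; δ]` as an algebra over `F = C ∩ Const(δ)`. -/
instance : Algebra δ.constField (DiffPoly δ) :=
  ((C δ).comp δ.constField.subtype).toAlgebra' (C_constField_comm δ)

end DiffPoly

/-- The idealiser `{g ∈ R | f g ∈ R f}` of `f` in the `k`-algebra `R`. -/
def idealiser (k : Type*) {R : Type*} [CommRing k] [Ring R] [Algebra k R] (f : R) :
    Subalgebra k R where
  carrier := {g | f ∣ᵣ f * g}
  mul_mem' := by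
    rintro x y ⟨q, hq⟩ ⟨r, hr⟩
    exact ⟨q * r, by rw [← mul_assoc, hq, mul_assoc, hr, mul_assoc]⟩
  add_mem' := by
    rintro x y ⟨q, hq⟩ ⟨r, hr⟩
    exact ⟨q + r, by rw [mul_add, hq, hr, add_mul]⟩
  algebraMap_mem' a := ⟨algebraMap k R a, (Algebra.commutes a f).symm⟩

/-- `R f` as an ideal of the idealiser of `f`. -/
def idealiserIdeal (k : Type*) {R : Type*} [CommRing k] [Ring R] [Algebra k R] (f : R) :
    Ideal (idealiser k f) where
  carrier := {g | f ∣ᵣ (g : R)}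
  add_mem' := by
    rintro x y ⟨q, hq⟩ ⟨r, hr⟩
    exact ⟨q + r, by rw [Subalgebra.coe_add, hq, hr, add_mul]⟩
  zero_mem' := ⟨0, by simp⟩
  smul_mem' := by
    rintro x y ⟨q, hq⟩
    exact ⟨x * q, by rw [smul_eq_mul, Subalgebra.coe_mul, hq, mul_assoc]⟩

instance (k : Type*) {R : Type*} [CommRing k] [Ring R] [Algebra k R] (f : R) :
    (idealiserIdeal k f).IsTwoSided where
  mul_mem_of_left := by
    rintro x y ⟨q, hq⟩
    obtain ⟨r, hr⟩ := y.2
    exact ⟨q * r, by rw [Subalgebra.coe_mul, hq, mul_assoc, hr, mul_assoc]⟩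

/-- The eigenring of `f`: the quotient of the idealiser of `f` by `R f`. -/
abbrev Eigenring (k : Type*) {R : Type*} [CommRing k] [Ring R] [Algebra k R] (f : R) : Type _ :=
  idealiser k f ⧸ idealiserIdeal k f

/-- `f` is a generalised A-polynomial: its eigenring is a (finite-dimensional) central simple
algebra over `F = C ∩ Const(δ)`. -/
def IsGeneralisedAPolynomial {D : Type*} [DivisionRing D] {δ : RingDerivation D}
    (f : DiffPoly δ) : Prop :=
  IsSimpleRing (Eigenring δ.constField f) ∧
    Algebra.IsCentral δ.constField (Eigenring δ.constField f) ∧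
    Module.Finite δ.constField (Eigenring δ.constField f)

/-- `h` is a central left multiple of `f`, nonzero and of minimal degree as such. -/
def IsMinimalCentralLeftMultiple {D : Type*} [Ring D] {δ : RingDerivation D}
    (f h : DiffPoly δ) : Prop :=
  h ≠ 0 ∧ h ∈ Subring.center (DiffPoly δ) ∧ f ∣ᵣ h ∧
    ∀ h' : DiffPoly δ, h' ≠ 0 → h' ∈ Subring.center (DiffPoly δ) → f ∣ᵣ h' →
      h.degree ≤ h'.degree

end

open Polynomial

noncomputable section

/-! Write `z = g(t) - c`, a central element of `R` of degree `p ^ e`.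

If the eigenring of `f` has centre `F`, then the class of `z`, being central, is some `b` in `F`, so
`z - b` lies in `R f` (`exists_rightDvd_sub_of_isCentral`). Degrees add in `R`, whence `deg f ≤ p ^
e`.

Conversely, let `z - b` lie in `R f` and put `S = R / R(z - b)`. The decisive fact is
`eq_C_of_mem_center`: central elements of `R` of degree below `p ^ e` are constants. Indeed Hasse
derivatives in `t` preserve the centre, so the nonconstant part of a central element of least
positive degree would be a `p`-polynomial over `F` whose value at `δ` is inner, against the
minimality of `g`. A minimal-degree argument then shows that `S` is simple with centre `F`
(`isSimpleRing_quotient`, `isCentral_quotient`). It is finite over `F` because `D` is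
(`finite_of_isInnerBy`), hence semisimple. The left ideal of `S` generated by the image of `f` is
therefore generated by an idempotent `1 - e`, and the eigenring of `f` is the corner `e S e`, which
inherits simplicity, centre and finiteness from `S`. The corner is nonzero because `f` is not a
unit: irreducibility makes `ĥ` nonconstant, so the minimal central left multiple of `f` has positive
degree. -/

/-- In a simple ring every nonzero element generates the unit ideal: explicit expression of `1`. -/
theorem IsSimpleRing.exists_sum_mul_mul_eq_one {S : Type*} [Ring S] [IsSimpleRing S]
    {w : S} (hw : w ≠ 0) : ∃ (n : ℕ) (x y : Fin n → S), ∑ i, x i * w * y i = 1 := by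
  have h1 : (1 : S) ∈ TwoSidedIdeal.span {w} :=
    IsSimpleRing.one_mem_of_ne_zero_mem _ hw (TwoSidedIdeal.subset_span rfl)
  rw [TwoSidedIdeal.mem_span_iff_mem_addSubgroup_closure,
    ← Submodule.span_int_eq_addSubgroupClosure] at h1
  obtain ⟨n, z, v, hv⟩ := Submodule.mem_span_set'.mp h1
  have hv' : ∀ i, ∃ a b : S, (v i : S) = a * w * b := by
    intro i
    have := (v i).2
    simp only [Set.mem_mul, Set.mem_univ, true_and, Set.mem_singleton_iff] at this
    grind
  choose a b hab using hv'
  refine ⟨n, fun i => z i • a i, b, ?_⟩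
  rw [← hv]
  exact Finset.sum_congr rfl fun i _ => by rw [hab, smul_mul_assoc, smul_mul_assoc]

/-! ### Corners `e S e` of central simple algebras -/

section Corner

variable {k A E S : Type*} [CommRing k] [Ring A] [Algebra k A] [Ring E] [Algebra k E]
  [Ring S] [Algebra k S] {e : S} (π : A →ₐ[k] E) (θ : A →ₗ[k] S)

/-- If `E` is identified with the corner `e S e` of a simple ring `S`, then `E` is simple. -/
theorem isSimpleRing_of_corner [IsSimpleRing S] (he : e ≠ 0) (hee : e * e = e)
    (hπ : Function.Surjective π) (hmul : ∀ x y, θ (x * y) = θ x * θ y) (hone : θ 1 = e)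
    (hker : ∀ x, θ x = 0 ↔ π x = 0) (hsurj : ∀ s, ∃ x, θ x = e * s * e) :
    IsSimpleRing E := by
  have hl : ∀ x, e * θ x = θ x := fun x => by rw [← hone, ← hmul, one_mul]
  have hr : ∀ x, θ x * e = θ x := fun x => by rw [← hone, ← hmul, mul_one]
  have : Nontrivial E := ⟨1, 0, fun h => he (by rw [← hone, hker, map_one, h])⟩
  refine IsSimpleRing.of_eq_bot_or_eq_top fun T => or_iff_not_imp_left.mpr fun hT => ?_
  obtain ⟨a, haT, ha0 : a ≠ 0⟩ := SetLike.exists_of_lt (bot_lt_iff_ne_bot.mpr hT)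
  obtain ⟨q, rfl⟩ := hπ a
  obtain ⟨n, x, y, hxy⟩ := IsSimpleRing.exists_sum_mul_mul_eq_one
    (w := θ q) (fun h => ha0 ((hker q).mp h))
  choose X hX using fun i => hsurj (x i)
  choose Y hY using fun i => hsurj (y i)
  have h1 : θ (∑ i, X i * q * Y i - 1) = 0 := by
    rw [map_sub, map_sum, hone, sub_eq_zero]
    -- Sandwiching by `e` replaces `x i` and `y i` by elements of the corner, since `e` is absorbed
    -- on both sides of `θ q`.
    have : e * (∑ i, x i * θ q * y i) * e = e := by rw [hxy, mul_one, hee]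
    rw [Finset.mul_sum, Finset.sum_mul] at this
    rw [← this]
    refine Finset.sum_congr rfl fun i _ => ?_
    rw [hmul, hmul, hX, hY]
    calc e * x i * e * θ q * (e * y i * e) = e * x i * (e * θ q * e) * y i * e := by noncomm_ring
      _ = _ := by rw [hl, hr]; noncomm_ring
  rw [hker, map_sub, map_one, sub_eq_zero] at h1
  rw [← TwoSidedIdeal.one_mem_iff, ← h1, map_sum]
  refine sum_mem fun i _ => ?_
  rw [map_mul, map_mul]
  exact T.mul_mem_right _ _ (T.mul_mem_left _ _ haT)

/-- If `E` is identified with the corner `e S e` of a central simple algebra `S`, then `E` is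
central. -/
theorem isCentral_of_corner [IsSimpleRing S] [Algebra.IsCentral k S] (he : e ≠ 0)
    (hee : e * e = e)
    (hπ : Function.Surjective π) (hmul : ∀ x y, θ (x * y) = θ x * θ y) (hone : θ 1 = e)
    (hker : ∀ x, θ x = 0 ↔ π x = 0) (hsurj : ∀ s, ∃ x, θ x = e * s * e) :
    Algebra.IsCentral k E := by
  have hl : ∀ x, e * θ x = θ x := fun x => by rw [← hone, ← hmul, one_mul]
  have hr : ∀ x, θ x * e = θ x := fun x => by rw [← hone, ← hmul, mul_one]
  refine ⟨fun a ha => ?_⟩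
  obtain ⟨q, rfl⟩ := hπ a
  have hcomm : ∀ s, e * s * e * θ q = θ q * (e * s * e) := by
    intro s
    obtain ⟨x, hx⟩ := hsurj s
    rw [← hx, ← hmul, ← hmul, ← sub_eq_zero, ← map_sub, hker, map_sub, map_mul, map_mul,
      sub_eq_zero]
    exact Subalgebra.mem_center_iff.mp ha _
  obtain ⟨n, x, y, hxy⟩ := IsSimpleRing.exists_sum_mul_mul_eq_one he
  -- With `∑ x i * e * y i = 1`, this `l` is the central element of `S` that restricts to `θ q` on
  -- the corner.
  set l : S := ∑ i, x i * θ q * y i with hldef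
  have hlc : l ∈ Subalgebra.center k S := by
    rw [Subalgebra.mem_center_iff]
    intro s
    -- `θ q` commutes with the corner element `e * (y j * s * x i) * e`, so it can jump from one
    -- factor to the other.
    have key : ∀ i j, x j * e * y j * s * (x i * θ q * y i) =
        x j * θ q * y j * s * (x i * e * y i) := by
      intro i j
      calc x j * e * y j * s * (x i * θ q * y i)
          = x j * (e * (y j * s * x i) * (e * θ q)) * y i := by
            rw [hl]; noncomm_ring
        _ = x j * (e * (y j * s * x i) * e * θ q) * y i := by noncomm_ring
        _ = x j * (θ q * e * (y j * s * x i) * e) * y i := by rw [hcomm]; noncomm_ring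
        _ = _ := by rw [hr]; noncomm_ring
    calc s * l = (∑ j, x j * e * y j) * s * l := by rw [hxy, one_mul]
      _ = l * s * ∑ i, x i * e * y i := by
        simp only [hldef, Finset.sum_mul, Finset.mul_sum]
        exact Finset.sum_congr rfl fun i _ => Finset.sum_congr rfl fun j _ => key _ _
      _ = l * s := by rw [hxy, mul_one]
  have hel : e * l * e = θ q := by
    calc e * l * e = ∑ i, (e * x i * e * θ q) * y i * e := by
          rw [hldef, Finset.mul_sum, Finset.sum_mul]
          refine Finset.sum_congr rfl fun i _ => ?_
          conv_lhs => rw [← hl q]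
          noncomm_ring
      _ = θ q * e * (∑ i, x i * e * y i) * e := by
          rw [Finset.mul_sum, Finset.sum_mul]
          refine Finset.sum_congr rfl fun i _ => ?_
          rw [hcomm]; noncomm_ring
      _ = θ q := by rw [hxy, mul_one, hr, hr]
  obtain ⟨r, hr'⟩ := Algebra.IsCentral.out hlc
  refine ⟨r, ?_⟩
  have : θ (algebraMap k A r - q) = 0 := by
    rw [map_sub, sub_eq_zero, ← hel, Algebra.algebraMap_eq_smul_one, map_smul, hone, ← hr']
    change _ = e * algebraMap k S r * e
    rw [← Algebra.commutes, mul_assoc, hee, Algebra.smul_def]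
  rw [hker, map_sub, sub_eq_zero, AlgHom.commutes] at this
  exact this

/-- `E` is a quotient of `A / ker θ`, which is isomorphic to a submodule of the Noetherian module
`S`. -/
theorem finite_of_ker_eq [IsNoetherian k S] (hπ : Function.Surjective π)
    (hker : ∀ x, θ x = 0 ↔ π x = 0) : Module.Finite k E := by
  have := Module.Finite.equiv θ.quotKerEquivRange.symm
  refine Module.Finite.of_surjective
    ((LinearMap.ker θ).liftQ π.toLinearMap fun x hx => (hker x).mp hx) fun a => ?_
  obtain ⟨x, rfl⟩ := hπ a
  exact ⟨Submodule.Quotient.mk x, rfl⟩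

end Corner

/-! ### The eigenring as a corner of a semisimple quotient -/

/-- Let `f` be a non-unit of `R`, and `φ : R → S` a surjection onto a central simple
semisimple algebra whose kernel lies in `R f`. Then the eigenring of `f` is central simple, and
finite. -/
theorem eigenring_isSimpleRing_isCentral_finite {k R S : Type*} [CommRing k] [Ring R] [Algebra k R]
    [Ring S] [Algebra k S] [IsSimpleRing S] [Algebra.IsCentral k S] [IsSemisimpleRing S]
    [IsNoetherian k S] (φ : R →ₐ[k] S) (hφ : Function.Surjective φ) (f : R) (hker : ∀ q, φ q = 0 → f ∣ᵣ q)
    (hf : ¬ f ∣ᵣ 1) :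
    IsSimpleRing (Eigenring k f) ∧ Algebra.IsCentral k (Eigenring k f) ∧
      Module.Finite k (Eigenring k f) := by
  obtain ⟨e', he', hspan⟩ := IsSemisimpleRing.ideal_eq_span_idempotent (Ideal.span {φ f})
  have hdvd : ∀ q, f ∣ᵣ q ↔ φ q ∈ Ideal.span {φ f} := by
    intro q
    rw [Ideal.mem_span_singleton']
    constructor
    · rintro ⟨r, rfl⟩
      exact ⟨φ r, (map_mul φ _ _).symm⟩
    · rintro ⟨s, hs⟩
      obtain ⟨r, rfl⟩ := hφ s
      obtain ⟨u, hu⟩ := hker (q - r * f) (by rw [map_sub, map_mul, hs, sub_self])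
      exact ⟨u + r, by rw [add_mul, ← hu, sub_add_cancel]⟩
  set e : S := 1 - e' with hedef
  have hee : e * e = e := he'.one_sub
  have hmem : ∀ s, s ∈ Ideal.span {φ f} ↔ s * e = 0 := by
    intro s
    rw [hspan, Ideal.mem_span_singleton', hedef, mul_sub, mul_one, sub_eq_zero]
    constructor
    · rintro ⟨a, rfl⟩
      rw [mul_assoc, he'.eq]
    · intro h
      exact ⟨s, h.symm⟩
  have he0 : e ≠ 0 := fun h => hf ((hdvd 1).mpr ((hmem _).mpr (by rw [h, mul_zero])))
  have hfe : φ f * e = 0 := (hmem _).mp (Ideal.mem_span_singleton_self _)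
  obtain ⟨y, hy⟩ : ∃ y, y * φ f = e' := by
    rw [← Ideal.mem_span_singleton', hspan]; exact Ideal.mem_span_singleton_self _
  -- `φ f` and `e'` are left multiples of each other, so `φ f * φ q * e = 0` amounts to `e' * φ q *
  -- e = 0`.
  have hid : ∀ q : R, q ∈ idealiser k f ↔ e * φ q * e = φ q * e := by
    intro q
    change f ∣ᵣ f * q ↔ _
    rw [hdvd, hmem, map_mul]
    constructor
    · intro h
      have : e' * φ q * e = 0 := by rw [← hy, mul_assoc, mul_assoc, ← mul_assoc (φ f), h, mul_zero]
      rw [hedef, sub_mul, sub_mul, one_mul, ← hedef, this, sub_zero]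
    · intro h
      rw [mul_assoc, ← h, ← mul_assoc, ← mul_assoc, hfe, zero_mul, zero_mul]
  let π : idealiser k f →ₐ[k] Eigenring k f := Ideal.Quotient.mkₐ k (idealiserIdeal k f)
  -- On the idealiser `φ q * e = e * φ q * e`, which makes `θ` multiplicative with values in the
  -- corner.
  let θ : idealiser k f →ₗ[k] S :=
    (LinearMap.mulRight k e) ∘ₗ φ.toLinearMap ∘ₗ (idealiser k f).val.toLinearMap
  have hθ : ∀ x, θ x = φ (x : R) * e := fun x => rfl
  have hπ : Function.Surjective π := Ideal.Quotient.mkₐ_surjective _ _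
  have hmul : ∀ x y, θ (x * y) = θ x * θ y := by
    intro x y
    rw [hθ, hθ, hθ, Subalgebra.coe_mul, map_mul, mul_assoc, mul_assoc (φ x) e, ← mul_assoc e,
      (hid _).mp y.2]
  have hone : θ 1 = e := by rw [hθ, Subalgebra.coe_one, map_one, one_mul]
  have hk : ∀ x, θ x = 0 ↔ π x = 0 := by
    intro x
    rw [hθ, ← hmem, ← hdvd]
    exact (Ideal.Quotient.eq_zero_iff_mem (I := idealiserIdeal k f) (a := x)).symm
  have hsurj : ∀ s, ∃ x, θ x = e * s * e := by
    intro s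
    obtain ⟨q, hq⟩ := hφ (e * s * e)
    refine ⟨⟨q, (hid q).mpr ?_⟩, ?_⟩
    · rw [hq]
      simp only [← mul_assoc, hee]
    · rw [hθ]
      change φ q * e = _
      rw [hq, mul_assoc, hee]
  exact ⟨isSimpleRing_of_corner π θ he0 hee hπ hmul hone hk hsurj,
    isCentral_of_corner π θ he0 hee hπ hmul hone hk hsurj, finite_of_ker_eq π θ hπ hk⟩

/-! ### Coefficients and the centre of `D[t; δ]` -/

namespace DiffPoly

section Ring

variable {D : Type*} [Ring D] {δ : RingDerivation D}

/-- The coefficient of `tⁿ`. -/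
def coeff (n : ℕ) : DiffPoly δ →+ D where
  toFun f := Polynomial.coeff (R := D) f n
  map_zero' := Polynomial.coeff_zero n
  map_add' p q := Polynomial.coeff_add p q n

theorem ext_coeff {f g : DiffPoly δ} (h : ∀ n, coeff n f = coeff n g) : f = g :=
  Polynomial.ext (R := D) h

theorem mapCoeff_coeff (q : D[X]) (n : ℕ) : (mapCoeff δ q).coeff n = δ (q.coeff n) := by
  induction q using Polynomial.induction_on' with
  | add p q hp hq => rw [map_add, Polynomial.coeff_add, hp, hq, Polynomial.coeff_add, map_add]
  | monomial m b =>
    rw [mapCoeff_monomial, Polynomial.coeff_monomial, Polynomial.coeff_monomial]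
    split_ifs
    · rfl
    · exact (map_zero δ).symm

theorem t_mul_eq (q : DiffPoly δ) : t δ * q = tMul δ q := by
  change lMul δ Polynomial.X q = _
  rw [← Polynomial.monomial_one_one_eq_X, lMul_monomial, pow_one, map_one, one_mul]

theorem C_mul_eq (a : D) (q : DiffPoly δ) : C δ a * q = cMul (D := D) a q := by
  change lMul δ (Polynomial.C a) q = _
  rw [← Polynomial.monomial_zero_left, lMul_monomial, pow_zero, mul_one]

theorem tMul_coeff_zero (q : D[X]) : (tMul δ q).coeff 0 = δ (q.coeff 0) := by
  change (q * Polynomial.X + mapCoeff δ q).coeff 0 = _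
  rw [Polynomial.coeff_add, mapCoeff_coeff, Polynomial.mul_coeff_zero, Polynomial.coeff_X_zero,
    mul_zero, zero_add]

theorem tMul_coeff_succ (q : D[X]) (n : ℕ) :
    (tMul δ q).coeff (n + 1) = q.coeff n + δ (q.coeff (n + 1)) := by
  change (q * Polynomial.X + mapCoeff δ q).coeff (n + 1) = _
  rw [Polynomial.coeff_add, mapCoeff_coeff, Polynomial.coeff_mul_X]

theorem coeff_t_mul_zero (q : DiffPoly δ) : coeff 0 (t δ * q) = δ (coeff 0 q) := by
  rw [t_mul_eq]
  exact tMul_coeff_zero (D := D) q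

theorem coeff_t_mul_succ (q : DiffPoly δ) (n : ℕ) :
    coeff (n + 1) (t δ * q) = coeff n q + δ (coeff (n + 1) q) := by
  rw [t_mul_eq]
  exact tMul_coeff_succ (D := D) q n

theorem coeff_C_mul (a : D) (q : DiffPoly δ) (n : ℕ) : coeff n (C δ a * q) = a * coeff n q := by
  rw [C_mul_eq]
  exact Polynomial.coeff_smul (R := D) a q n

theorem coeff_C_mul_t_pow (a : D) (m n : ℕ) :
    coeff n (C δ a * t δ ^ m) = if m = n then a else 0 := by
  rw [C_mul_t_pow]
  exact Polynomial.coeff_monomial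

theorem coeff_C (a : D) (n : ℕ) : coeff n (C δ a) = if n = 0 then a else 0 := by
  have h := coeff_C_mul_t_pow (δ := δ) a 0 n
  rw [pow_zero, mul_one] at h
  simp only [h, eq_comm]

@[elab_as_elim]
theorem induction_on {motive : DiffPoly δ → Prop} (q : DiffPoly δ)
    (add : ∀ p q, motive p → motive q → motive (p + q))
    (mul : ∀ (a : D) (n : ℕ), motive (C δ a * t δ ^ n)) : motive q :=
  Polynomial.induction_on' (R := D) (motive := motive) q add
    fun n a => by rw [← C_mul_t_pow]; exact mul a n

theorem exists_forall_coeff_eq_zero (q : DiffPoly δ) : ∃ m, ∀ n, m ≤ n → coeff n q = 0 :=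
  ⟨Polynomial.natDegree (R := D) q + 1, fun _ hn =>
    Polynomial.coeff_eq_zero_of_natDegree_lt (R := D) hn⟩

theorem coeff_mul_t_zero (q : DiffPoly δ) : coeff 0 (q * t δ) = 0 := by
  induction q using induction_on with
  | add p q hp hq => rw [add_mul, map_add, hp, hq, add_zero]
  | mul a n => rw [mul_assoc, ← pow_succ, coeff_C_mul_t_pow, if_neg (by omega)]

theorem coeff_mul_t_succ (q : DiffPoly δ) (n : ℕ) : coeff (n + 1) (q * t δ) = coeff n q := by
  induction q using induction_on with
  | add p q hp hq => rw [add_mul, map_add, map_add, hp, hq]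
  | mul a m =>
    rw [mul_assoc, ← pow_succ, coeff_C_mul_t_pow, coeff_C_mul_t_pow]
    simp only [Nat.succ_inj]

theorem coeff_commutator_t (q : DiffPoly δ) (n : ℕ) :
    coeff n (t δ * q - q * t δ) = δ (coeff n q) := by
  cases n with
  | zero => rw [map_sub, coeff_t_mul_zero, coeff_mul_t_zero, sub_zero]
  | succ n => rw [map_sub, coeff_t_mul_succ, coeff_mul_t_succ, add_sub_cancel_left]

theorem commute_t_iff (q : DiffPoly δ) : t δ * q = q * t δ ↔ ∀ n, δ (coeff n q) = 0 := by
  rw [← sub_eq_zero]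
  constructor
  · intro h n
    rw [← coeff_commutator_t, h, map_zero]
  · intro h
    exact ext_coeff fun n => by rw [coeff_commutator_t, h, map_zero]

theorem mem_center_iff (q : DiffPoly δ) :
    q ∈ Subring.center (DiffPoly δ) ↔
      (∀ a, C δ a * q = q * C δ a) ∧ ∀ n, δ (coeff n q) = 0 := by
  rw [Subring.mem_center_iff, ← commute_t_iff]
  refine ⟨fun h => ⟨fun a => h _, h _⟩, fun ⟨h1, h2⟩ r => ?_⟩
  induction r using induction_on with
  | add r s hr hs => rw [add_mul, mul_add, hr, hs]
  | mul a n => exact (Commute.mul_left (h1 a) (Commute.pow_left h2 n) : Commute _ _)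

/-! ### Degrees of products -/

/-- Moving `t` past a coefficient only creates terms of lower degree, so leading terms multiply as
in `D[X]`. -/
theorem coeff_t_pow_mul {q : DiffPoly δ} {m : ℕ} (hq : ∀ n, m < n → coeff n q = 0) (i : ℕ) :
    (∀ n, i + m < n → coeff n (t δ ^ i * q) = 0) ∧ coeff (i + m) (t δ ^ i * q) = coeff m q := by
  induction i with
  | zero => simpa using hq
  | succ i ih =>
    have hs : i + 1 + m = i + m + 1 := by omega
    constructor
    · rintro (_ | n) hn
      · omega
      · rw [pow_succ', mul_assoc, coeff_t_mul_succ, ih.1 n (by omega), ih.1 (n + 1) (by omega),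
          map_zero, add_zero]
    · rw [hs, pow_succ', mul_assoc, coeff_t_mul_succ, ih.2, ih.1 _ (by omega), map_zero, add_zero]

theorem eq_sum_range {p : DiffPoly δ} {n : ℕ} (hp : ∀ i, n ≤ i → coeff i p = 0) :
    p = ∑ i ∈ Finset.range n, C δ (coeff i p) * t δ ^ i := by
  refine ext_coeff fun j => ?_
  rw [map_sum]
  simp only [coeff_C_mul_t_pow]
  rw [Finset.sum_ite_eq']
  split_ifs with h
  · rfl
  · exact hp j (by simpa using h)

theorem coeff_mul_of_lt {p q : DiffPoly δ} {n m : ℕ} (hp : ∀ i, n < i → coeff i p = 0)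
    (hq : ∀ i, m < i → coeff i q = 0) {k : ℕ} (hk : n + m < k) : coeff k (p * q) = 0 := by
  rw [eq_sum_range (p := p) (n := n + 1) (fun i hi => hp i hi), Finset.sum_mul, map_sum]
  refine Finset.sum_eq_zero fun i hi => ?_
  rw [mul_assoc, coeff_C_mul, (coeff_t_pow_mul hq i).1 k, mul_zero]
  rw [Finset.mem_range] at hi
  omega

theorem coeff_mul_add {p q : DiffPoly δ} {n m : ℕ} (hp : ∀ i, n < i → coeff i p = 0)
    (hq : ∀ i, m < i → coeff i q = 0) : coeff (n + m) (p * q) = coeff n p * coeff m q := by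
  conv_lhs => rw [eq_sum_range (p := p) (n := n + 1) (fun i hi => hp i hi)]
  rw [Finset.sum_range_succ, add_mul, map_add, mul_assoc, coeff_C_mul,
    (coeff_t_pow_mul hq n).2, Finset.sum_mul, map_sum, Finset.sum_eq_zero, zero_add]
  intro i hi
  rw [mul_assoc, coeff_C_mul, (coeff_t_pow_mul hq i).1, mul_zero]
  rw [Finset.mem_range] at hi
  omega

theorem exists_degree_eq {p : DiffPoly δ} (hp : p ≠ 0) :
    ∃ n : ℕ, degree p = n ∧ coeff n p ≠ 0 ∧ ∀ i, n < i → coeff i p = 0 :=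
  ⟨Polynomial.natDegree (R := D) p, Polynomial.degree_eq_natDegree (R := D) hp,
    fun h => hp (Polynomial.leadingCoeff_eq_zero (R := D).mp h),
    fun _ hi => Polynomial.coeff_eq_zero_of_natDegree_lt (R := D) hi⟩

theorem degree_eq_of_coeff {p : DiffPoly δ} {n : ℕ} (h0 : coeff n p ≠ 0)
    (h : ∀ i, n < i → coeff i p = 0) : degree p = n :=
  le_antisymm ((Polynomial.degree_le_iff_coeff_zero (R := D) p n).mpr
    fun m hm => h m (WithBot.coe_lt_coe.mp hm))
    (Polynomial.le_degree_of_ne_zero (R := D) h0)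

theorem coeff_eq_zero_of_degree_lt {p : DiffPoly δ} {n : ℕ} (h : degree p < n) :
    coeff n p = 0 := Polynomial.coeff_eq_zero_of_degree_lt (R := D) h

theorem degree_mul [NoZeroDivisors D] (p q : DiffPoly δ) :
    degree (p * q) = degree p + degree q := by
  by_cases hp : p = 0
  · rw [hp, zero_mul]
    exact (WithBot.bot_add _).symm
  by_cases hq : q = 0
  · rw [hq, mul_zero]
    exact (WithBot.add_bot _).symm
  obtain ⟨n, hn, hn0, hpn⟩ := exists_degree_eq hp
  obtain ⟨m, hm, hm0, hqm⟩ := exists_degree_eq hq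
  rw [hn, hm, ← Nat.cast_add]
  refine degree_eq_of_coeff ?_ fun i hi => coeff_mul_of_lt hpn hqm hi
  rw [coeff_mul_add hpn hqm]
  exact mul_ne_zero hn0 hm0

theorem degree_eq_bot_iff {p : DiffPoly δ} : degree p = ⊥ ↔ p = 0 :=
  Polynomial.degree_eq_bot (R := D)

instance [Nontrivial D] : Nontrivial (DiffPoly δ) :=
  inferInstanceAs (Nontrivial D[X])

instance [NoZeroDivisors D] : NoZeroDivisors (DiffPoly δ) where
  eq_zero_or_eq_zero_of_mul_eq_zero {p q} h := by
    rwa [← degree_eq_bot_iff, degree_mul, WithBot.add_eq_bot, degree_eq_bot_iff,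
      degree_eq_bot_iff] at h

/-- Right division with remainder by a monic element. -/
theorem exists_eq_mul_add {u : DiffPoly δ} {N : ℕ} (hu : coeff N u = 1)
    (hu' : ∀ i, N < i → coeff i u = 0) (q : DiffPoly δ) :
    ∃ s r, q = s * u + r ∧ ∀ i, N ≤ i → coeff i r = 0 := by
  obtain ⟨m, hm⟩ := exists_forall_coeff_eq_zero q
  induction m generalizing q with
  | zero => exact ⟨0, q, by rw [zero_mul, zero_add], fun i _ => hm i (Nat.zero_le _)⟩
  | succ m ih =>
    by_cases hmN : m < N
    · exact ⟨0, q, by rw [zero_mul, zero_add], fun i hi => hm i (by omega)⟩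
    obtain ⟨j, rfl⟩ : ∃ j, m = j + N := ⟨m - N, by omega⟩
    have hj : ∀ i, j < i → coeff i (C δ (coeff (j + N) q) * t δ ^ j) = 0 := fun i hi => by
      rw [coeff_C_mul_t_pow, if_neg (by omega)]
    obtain ⟨s, r, hq, hr⟩ := ih (q - C δ (coeff (j + N) q) * t δ ^ j * u) (by
      intro n hn
      rw [map_sub]
      rcases hn.eq_or_lt with rfl | hn
      · rw [coeff_mul_add hj hu', hu, coeff_C_mul_t_pow, if_pos rfl, mul_one, sub_self]
      · rw [coeff_mul_of_lt hj hu' hn, hm _ (by omega), sub_zero])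
    exact ⟨s + C δ (coeff (j + N) q) * t δ ^ j, r,
      by rw [add_mul, add_right_comm, ← hq, sub_add_cancel], hr⟩

/-! ### Hasse derivatives with respect to `t` -/

/-- The Hasse derivative `b tⁱ ↦ (i choose j) b tⁱ⁻ʲ` on `D[t; δ]`. -/
def hasse (j : ℕ) : DiffPoly δ →+ DiffPoly δ :=
  (Polynomial.hasseDeriv (R := D) j).toAddMonoidHom

theorem coeff_hasse (j n : ℕ) (q : DiffPoly δ) :
    coeff n (hasse j q) = ((n + j).choose j : D) * coeff (n + j) q :=
  Polynomial.hasseDeriv_coeff (R := D) j q n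

theorem hasse_C_mul (j : ℕ) (a : D) (q : DiffPoly δ) :
    hasse j (C δ a * q) = C δ a * hasse j q := by
  refine ext_coeff fun n => ?_
  rw [coeff_hasse, coeff_C_mul, coeff_C_mul, coeff_hasse, ← mul_assoc, ← mul_assoc,
    (Nat.cast_commute _ a).eq]

theorem hasse_zero (q : DiffPoly δ) : hasse 0 q = q :=
  ext_coeff fun n => by simp [coeff_hasse]

theorem map_natCast_mul (δ : RingDerivation D) (n : ℕ) (a : D) :
    δ ((n : D) * a) = (n : D) * δ a := by
  rw [← nsmul_eq_mul, ← nsmul_eq_mul, map_nsmul]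

/-- Pascal's rule. No `δ` appears in the correction term because integer multiples commute with `δ`.
-/
theorem hasse_succ_t_mul (j : ℕ) (q : DiffPoly δ) :
    hasse (j + 1) (t δ * q) = t δ * hasse (j + 1) q + hasse j q := by
  refine ext_coeff fun n => ?_
  rw [map_add, coeff_hasse, coeff_hasse, ← add_assoc, coeff_t_mul_succ]
  cases n with
  | zero =>
    rw [coeff_t_mul_zero, coeff_hasse, map_natCast_mul]
    simp [add_comm]
  | succ n =>
    rw [coeff_t_mul_succ, coeff_hasse, coeff_hasse, map_natCast_mul,
      show n + 1 + (j + 1) = n + (j + 1) + 1 by omega, show n + 1 + j = n + (j + 1) by omega,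
      Nat.choose_succ_succ]
    push_cast
    noncomm_ring

/-- The recursion `hasse_succ_t_mul` for left multiplication by `t` is compatible with right
multiplication by a constant, so induction on the power of `t` applies. This is what makes Hasse
derivatives preserve the centre. -/
theorem hasse_mul_C (j : ℕ) (q : DiffPoly δ) (a : D) :
    hasse j (q * C δ a) = hasse j q * C δ a := by
  induction q using induction_on generalizing j with
  | add p q hp hq => rw [add_mul, map_add, map_add, hp, hq, add_mul]
  | mul b n =>
    rw [mul_assoc, hasse_C_mul, hasse_C_mul, mul_assoc]
    congr 1
    induction n generalizing j with
    | zero =>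
      rw [pow_zero, one_mul]
      refine ext_coeff fun m => ?_
      rw [← map_one (C δ)]
      cases j with
      | zero => rw [hasse_zero, hasse_zero, map_one, one_mul]
      | succ j =>
        have h : hasse (j + 1) (C δ 1) = 0 := ext_coeff fun m => by
          rw [coeff_hasse, coeff_C, if_neg (by omega), mul_zero, map_zero]
        rw [h, zero_mul, coeff_hasse, coeff_C, if_neg (by omega), mul_zero, map_zero]
    | succ n ih =>
      cases j with
      | zero => rw [hasse_zero, hasse_zero]
      | succ j =>
        rw [pow_succ', mul_assoc, hasse_succ_t_mul, hasse_succ_t_mul, ih, ih, add_mul, mul_assoc]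

theorem hasse_mem_center (j : ℕ) {q : DiffPoly δ} (hq : q ∈ Subring.center (DiffPoly δ)) :
    hasse j q ∈ Subring.center (DiffPoly δ) := by
  rw [mem_center_iff] at hq ⊢
  refine ⟨fun a => by rw [← hasse_mul_C, ← hasse_C_mul, hq.1], fun n => ?_⟩
  rw [coeff_hasse, map_natCast_mul, hq.2, mul_zero]

theorem coeff_zero_mul_C {q : DiffPoly δ} {m : ℕ} (hq : ∀ i, m ≤ i → coeff i q = 0) (a : D) :
    coeff 0 (q * C δ a) = ∑ i ∈ Finset.range m, coeff i q * (δ^[i]) a := by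
  have h : ∀ n, coeff 0 (t δ ^ n * C δ a) = (δ^[n]) a := by
    intro n
    induction n with
    | zero => rw [pow_zero, one_mul, coeff_C, if_pos rfl]; rfl
    | succ n ih =>
      rw [pow_succ', mul_assoc, coeff_t_mul_zero, ih, Function.iterate_succ_apply']
  conv_lhs => rw [eq_sum_range hq]
  rw [Finset.sum_mul, map_sum]
  exact Finset.sum_congr rfl fun i _ => by rw [mul_assoc, coeff_C_mul, h]

end Ring

end DiffPoly

/-! ### Central elements of low degree -/

/-- If `p ∤ n`, take `j = 1`; otherwise descend by `(pm choose pj) ≡ (m choose j)` modulo `p`. -/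
theorem Nat.Prime.exists_not_dvd_choose {p : ℕ} (hp : p.Prime) {n : ℕ} (hn : n ≠ 0)
    (h : ¬ ∃ i, n = p ^ i) : ∃ j, 0 < j ∧ j < n ∧ ¬ p ∣ n.choose j := by
  have := Fact.mk hp
  induction n using Nat.strong_induction_on with
  | _ n ih =>
    by_cases hpn : p ∣ n
    · obtain ⟨m, rfl⟩ := hpn
      have hm : m ≠ 0 := by rintro rfl; simp at hn
      obtain ⟨j, hj, hjm, hc⟩ := ih m (by nlinarith [hp.two_le, Nat.pos_of_ne_zero hm]) hm (by
        rintro ⟨i, rfl⟩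
        exact h ⟨i + 1, by rw [pow_succ']⟩)
      refine ⟨p * j, Nat.mul_pos hp.pos hj, Nat.mul_lt_mul_of_pos_left hjm hp.pos, ?_⟩
      rwa [(Choose.choose_mul_mul_modEq_choose_nat (p := p)).dvd_iff dvd_rfl]
    · refine ⟨1, one_pos, ?_, by rwa [Nat.choose_one_right]⟩
      have : n ≠ 1 := fun h1 => h ⟨0, by rw [h1, pow_zero]⟩
      omega

namespace RingDerivation

variable {D : Type*} [DivisionRing D] (δ : RingDerivation D)

theorem toEnd_pow_apply (i : ℕ) (a : D) : (δ.toEnd ^ i) a = (δ^[i]) a := by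
  induction i with
  | zero => rfl
  | succ i ih =>
    rw [pow_succ', Function.iterate_succ_apply', ← ih]
    rfl

theorem aeval_toEnd_apply {g : (δ.constField)[X]} {n : ℕ} (hn : g.natDegree < n) (a : D) :
    aeval δ.toEnd g a = ∑ i ∈ Finset.range n, (g.coeff i : D) * (δ^[i]) a := by
  rw [aeval_eq_sum_range' hn, LinearMap.sum_apply]
  refine Finset.sum_congr rfl fun i _ => ?_
  rw [LinearMap.smul_apply, toEnd_pow_apply]
  rfl

end RingDerivation

namespace DiffPoly

variable {D : Type*} [DivisionRing D] {δ : RingDerivation D}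

theorem algebraMap_eq (a : δ.constField) : algebraMap δ.constField (DiffPoly δ) a = C δ (a : D) :=
  rfl

theorem smul_eq (a : δ.constField) (q : DiffPoly δ) : a • q = C δ (a : D) * q :=
  Algebra.smul_def a q

theorem coeff_smul (a : δ.constField) (q : DiffPoly δ) (n : ℕ) :
    coeff n (a • q) = (a : D) * coeff n q := by
  rw [smul_eq, coeff_C_mul]

theorem coeff_aeval_t (g : (δ.constField)[X]) (n : ℕ) :
    coeff n (aeval (t δ) g) = (g.coeff n : D) := by
  induction g using Polynomial.induction_on' with
  | add p q hp hq => rw [map_add, map_add, hp, hq, Polynomial.coeff_add]; rfl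
  | monomial m b =>
    rw [aeval_monomial, algebraMap_eq, coeff_C_mul_t_pow, Polynomial.coeff_monomial]
    split_ifs <;> rfl

theorem C_mem_center_iff {b : D} : C δ b ∈ Subring.center (DiffPoly δ) ↔ b ∈ δ.constField := by
  rw [mem_center_iff, RingDerivation.mem_constField, Subring.mem_center_iff]
  refine and_congr (forall_congr' fun a => ?_) ⟨fun h => ?_, fun h n => ?_⟩
  · rw [← map_mul, ← map_mul]
    refine ⟨fun h => ?_, fun h => by rw [h]⟩
    have := congrArg (coeff 0) h
    rwa [coeff_C, coeff_C, if_pos rfl, if_pos rfl] at this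
  · have := h 0
    rwa [coeff_C, if_pos rfl] at this
  · rw [coeff_C]
    split_ifs
    · exact h
    · exact map_zero δ

/-- A central element of `D[t; δ]` of degree less than that of the minimum `p`-polynomial of `δ`
is constant. -/
theorem eq_C_of_mem_center {p : ℕ} [hp : Fact p.Prime] [CharP D p] {N : ℕ}
    (hN : ∀ g' : (δ.constField)[X], g'.Monic → IsPPolynomial p g' →
      (∃ c : D, IsInnerBy (aeval δ.toEnd g') c) → N ≤ g'.natDegree)
    {u : DiffPoly δ} (hu : u ∈ Subring.center (DiffPoly δ)) (huN : ∀ i, N ≤ i → coeff i u = 0) :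
    u = C δ (coeff 0 u) := by
  suffices H : ∀ m, m ≤ N → ∀ u ∈ Subring.center (DiffPoly δ), (∀ i, m ≤ i → coeff i u = 0) →
      u = C δ (coeff 0 u) from H N le_rfl u hu huN
  clear hu huN u
  intro m
  induction m with
  | zero =>
    intro _ u _ h
    refine ext_coeff fun n => ?_
    rw [h n (Nat.zero_le n), h 0 le_rfl, map_zero, map_zero]
  | succ m ih =>
    intro hmN u hu h
    by_cases hum : coeff m u = 0
    · refine ih (by omega) u hu fun i hi => ?_
      rcases hi.eq_or_lt with rfl | hi
      · exact hum
      · exact h i hi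
    obtain rfl | hm := Nat.eq_zero_or_pos m
    · refine ext_coeff fun n => ?_
      rw [coeff_C]
      split_ifs with h0
      · rw [h0]
      · exact h n (by omega)
    exfalso
    -- A proper Hasse derivative of `u` is central of smaller degree, hence constant by induction;
    -- its constant term is the `j`-th coefficient of `u`.
    have hH : ∀ j, 0 < j → hasse j u = C δ (coeff j u) := by
      intro j hj
      rw [ih (by omega) _ (hasse_mem_center j hu) fun i hi => by
        rw [coeff_hasse, h _ (by omega), mul_zero], coeff_hasse, zero_add, Nat.choose_self,
        Nat.cast_one, one_mul]
    have hF : ∀ j, coeff (j + 1) u ∈ δ.constField := by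
      intro j
      rw [← C_mem_center_iff, ← hH _ (Nat.succ_pos j)]
      exact hasse_mem_center _ hu
    -- The coefficient of `t ^ (n - j)` in the constant `hasse j u` is `(n choose j)` times that of
    -- `t ^ n` in `u`; choose `j` so that the binomial is invertible.
    have hpow : ∀ n, n ≠ 0 → (¬ ∃ i, n = p ^ i) → coeff n u = 0 := by
      intro n hn hni
      obtain ⟨j, hj, hjn, hc⟩ := hp.out.exists_not_dvd_choose hn hni
      have h1 : coeff (n - j) (hasse j u) = 0 := by
        rw [hH j hj, coeff_C, if_neg (by omega)]
      rw [coeff_hasse, Nat.sub_add_cancel hjn.le, mul_eq_zero, CharP.cast_eq_zero_iff D p] at h1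
      exact h1.resolve_left hc
    let β : ℕ → δ.constField := fun j => ⟨coeff (j + 1) u, hF j⟩
    have hβm : β (m - 1) ≠ 0 := by
      intro h0
      apply hum
      have := congrArg Subtype.val h0
      rwa [← Nat.sub_add_cancel hm]
    set l : δ.constField := (β (m - 1))⁻¹ with hl
    -- The nonconstant part of `u`, divided by its leading coefficient; `β` is shifted by one to
    -- skip the constant term.
    let g' : (δ.constField)[X] := ∑ j ∈ Finset.range m, Polynomial.monomial (j + 1) (l * β j)
    have hg0 : g'.coeff 0 = 0 := by
      rw [Polynomial.finsetSum_coeff]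
      exact Finset.sum_eq_zero fun j _ => Polynomial.coeff_monomial_of_ne _ (by omega)
    have hgs : ∀ k, k < m → g'.coeff (k + 1) = l * β k := by
      intro k hk
      rw [Polynomial.finsetSum_coeff, Finset.sum_eq_single k]
      · rw [Polynomial.coeff_monomial_same]
      · intro j _ hj
        exact Polynomial.coeff_monomial_of_ne _ (by omega)
      · intro hk'
        exact absurd (Finset.mem_range.mpr hk) hk'
    have hgd : g'.natDegree ≤ m := by
      refine Polynomial.natDegree_sum_le_of_forall_le _ _ fun j hj => ?_
      exact (Polynomial.natDegree_monomial_le _).trans (by rw [Finset.mem_range] at hj; omega)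
    have hgm : g'.Monic := by
      refine Polynomial.monic_of_natDegree_le_of_coeff_eq_one m hgd ?_
      have := hgs (m - 1) (by omega)
      rwa [Nat.sub_add_cancel hm, hl, inv_mul_cancel₀ hβm] at this
    have hgp : IsPPolynomial p g' := by
      intro n hn
      by_contra hni
      rw [Polynomial.mem_support_iff] at hn
      apply hn
      obtain _ | k := n
      · exact hg0
      by_cases hk : k < m
      · rw [hgs k hk, show β k = 0 from Subtype.ext (hpow _ (Nat.succ_ne_zero k) hni), mul_zero]
      · exact Polynomial.coeff_eq_zero_of_natDegree_lt (by omega)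
    -- Compare constant terms in `a * u = u * a`: on the right they are the sum of `coeff i u *
    -- δ^[i] a`.
    have hgi : IsInnerBy (aeval δ.toEnd g') (-((l : D) * coeff 0 u)) := by
      intro a
      have h1 := congrArg (coeff 0) (((mem_center_iff u).mp hu).1 a)
      rw [coeff_C_mul, coeff_zero_mul_C h, Finset.sum_range_succ'] at h1
      rw [RingDerivation.aeval_toEnd_apply δ (Nat.lt_succ_of_le hgd), Finset.sum_range_succ', hg0]
      have h2 : ∑ k ∈ Finset.range m, (g'.coeff (k + 1) : D) * (δ^[k + 1]) a =
          l * ∑ k ∈ Finset.range m, coeff (k + 1) u * (δ^[k + 1]) a := by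
        rw [Finset.mul_sum]
        refine Finset.sum_congr rfl fun k hk => ?_
        rw [hgs k (Finset.mem_range.mp hk), ← mul_assoc]
        rfl
      rw [h2, eq_sub_of_add_eq h1.symm]
      have h3 := δ.constField_comm l a
      rw [mul_sub, mul_neg, ← mul_assoc a, ← h3]
      simp only [Function.iterate_zero, id_eq, ZeroMemClass.coe_zero, zero_mul, add_zero]
      noncomm_ring
    have := hN g' hgm hgp ⟨_, hgi⟩
    omega

end DiffPoly

/-! ### The central element `g(t) - c` and the quotients by `g(t) - (b + c)` -/

namespace DiffPoly

variable {D : Type*} [DivisionRing D] {δ : RingDerivation D}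

theorem coeff_mul_C {q : DiffPoly δ} {m : ℕ} (hq : ∀ i, m ≤ i → coeff i q = 0) (a : D) (k : ℕ) :
    coeff k (q * C δ a) =
      ∑ i ∈ Finset.range m, ((i + k).choose k : D) * coeff (i + k) q * (δ^[i]) a := by
  have h := coeff_hasse k 0 (q * C δ a)
  rw [zero_add, Nat.choose_self, Nat.cast_one, one_mul, hasse_mul_C,
    coeff_zero_mul_C (m := m) fun i hi => by rw [coeff_hasse, hq _ (by omega), mul_zero]] at h
  rw [← h]
  exact Finset.sum_congr rfl fun i _ => by rw [coeff_hasse]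

/-- In the coefficient of `t ^ k` in `g(t) * a`, the terms with `i, k > 0` carry `(i + k choose k)`,
divisible by `p` when `i + k` is a power of `p`. Only `i = 0` and `k = 0` survive. -/
theorem aeval_t_mul_C {p : ℕ} [hp : Fact p.Prime] [CharP D p] {g : (δ.constField)[X]}
    (hg : IsPPolynomial p g) (a : D) :
    aeval (t δ) g * C δ a = C δ a * aeval (t δ) g + C δ (aeval δ.toEnd g a) := by
  have hd : ∀ i, g.natDegree + 1 ≤ i → coeff i (aeval (t δ) g) = 0 := fun i hi => by
    rw [coeff_aeval_t, Polynomial.coeff_eq_zero_of_natDegree_lt (by omega)]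
    rfl
  have hg0 : g.coeff 0 = 0 := by
    by_contra h
    obtain ⟨i, hi⟩ := hg 0 (Polynomial.mem_support_iff.mpr h)
    exact pow_ne_zero i hp.out.ne_zero hi.symm
  refine ext_coeff fun k => ?_
  rw [map_add, coeff_C_mul, coeff_aeval_t, coeff_C, coeff_mul_C hd]
  simp only [coeff_aeval_t]
  obtain _ | k := k
  · rw [if_pos rfl, δ.aeval_toEnd_apply (Nat.lt_succ_self _), hg0]
    simp
  · rw [if_neg (Nat.succ_ne_zero k), add_zero, Finset.sum_range_succ', Finset.sum_eq_zero]
    · simp [δ.constField_comm]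
    · intro i _
      by_cases h : g.coeff (i + 1 + (k + 1)) = 0
      · rw [h, ZeroMemClass.coe_zero, mul_zero, zero_mul]
      · obtain ⟨j, hj⟩ := hg _ (Polynomial.mem_support_iff.mpr h)
        rw [hj, (CharP.cast_eq_zero_iff D p _).mpr, zero_mul, zero_mul]
        exact hp.out.dvd_choose_pow (by omega) (by omega)

/-- If `g(δ)` is the inner derivation by the constant `c`, then `g(t) - c` is central. -/
theorem aeval_t_sub_C_mem_center {p : ℕ} [Fact p.Prime] [CharP D p] {g : (δ.constField)[X]}
    (hg : IsPPolynomial p g) {c : D} (hc : IsInnerBy (aeval δ.toEnd g) c) (hδc : δ c = 0) :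
    aeval (t δ) g - C δ c ∈ Subring.center (DiffPoly δ) := by
  rw [mem_center_iff]
  constructor
  · intro a
    rw [sub_mul, aeval_t_mul_C hg, hc a, mul_sub, ← map_mul, ← map_mul, map_sub]
    abel
  · intro n
    rw [map_sub, coeff_aeval_t, coeff_C, map_sub, (g.coeff n).2.2]
    split_ifs <;> simp [hδc]

section Quotient

variable {z : DiffPoly δ} {N : ℕ}

theorem eq_zero_of_mem_span_of_coeff_eq_zero
    (hzN : coeff N z = 1) (hzN' : ∀ i, N < i → coeff i z = 0) {q : DiffPoly δ} (hq : q ∈ Ideal.span {z})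
    (hqN : ∀ i, N ≤ i → coeff i q = 0) : q = 0 := by
  obtain ⟨s, rfl⟩ := Ideal.mem_span_singleton'.mp hq
  by_contra h0
  obtain ⟨m, -, hm, hm'⟩ := exists_degree_eq (left_ne_zero_of_mul h0)
  have := coeff_mul_add hm' hzN'
  rw [hqN _ (by omega), hzN, mul_one] at this
  exact hm this.symm

theorem isTwoSided_span_of_mem_center
    (hz : z ∈ Subring.center (DiffPoly δ)) : (Ideal.span {z}).IsTwoSided := by
  refine ⟨fun {a} b ha => ?_⟩
  obtain ⟨s, rfl⟩ := Ideal.mem_span_singleton'.mp ha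
  rw [mul_assoc, ← Subring.mem_center_iff.mp hz b, ← mul_assoc]
  exact Ideal.mul_mem_left _ _ (Ideal.mem_span_singleton_self z)

variable [(Ideal.span {z}).IsTwoSided]

theorem exists_mk_eq
    (hzN : coeff N z = 1) (hzN' : ∀ i, N < i → coeff i z = 0) (s : DiffPoly δ ⧸ Ideal.span {z}) :
    ∃ u : DiffPoly δ, (∀ i, N ≤ i → coeff i u = 0) ∧ Ideal.Quotient.mk (Ideal.span {z}) u = s := by
  obtain ⟨q, rfl⟩ := Ideal.Quotient.mk_surjective s
  obtain ⟨s, r, rfl, hr⟩ := exists_eq_mul_add hzN hzN' q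
  refine ⟨r, hr, ?_⟩
  rw [map_add, right_eq_add, Ideal.Quotient.eq_zero_iff_mem]
  exact Ideal.mul_mem_left _ _ (Ideal.mem_span_singleton_self z)

theorem coeff_commutator_C {u : DiffPoly δ} {m : ℕ} (hu : ∀ i, m < i → coeff i u = 0) (a : D) :
    (∀ i, m < i → coeff i (u * C δ a - C δ a * u) = 0) ∧
      coeff m (u * C δ a - C δ a * u) = coeff m u * a - a * coeff m u := by
  have hC : ∀ i, 0 < i → coeff i (C δ a) = 0 := fun i hi => by rw [coeff_C, if_neg (by omega)]
  constructor
  · intro i hi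
    rw [map_sub, coeff_mul_of_lt hu hC (by omega), coeff_C_mul, hu i hi, mul_zero, sub_zero]
  · rw [map_sub, coeff_C_mul]
    have := coeff_mul_add hu hC
    rw [add_zero, coeff_C, if_pos rfl] at this
    rw [this]

/-- A monic representative of least degree in a nonzero ideal has commutators with `t` and with `D`
of smaller degree, still in the ideal, hence zero. So it is central of degree below `N`, thus a
nonzero constant, and the ideal contains `1`. -/
theorem isSimpleRing_quotient
    (hN0 : 0 < N) (hzN : coeff N z = 1) (hzN' : ∀ i, N < i → coeff i z = 0)
    (hcen : ∀ u ∈ Subring.center (DiffPoly δ), (∀ i, N ≤ i → coeff i u = 0) →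
      u = C δ (coeff 0 u)) : IsSimpleRing (DiffPoly δ ⧸ Ideal.span {z}) := by
  have hne : (1 : DiffPoly δ ⧸ Ideal.span {z}) ≠ 0 := by
    rw [← map_one (Ideal.Quotient.mk _), Ne, Ideal.Quotient.eq_zero_iff_mem]
    intro h
    have h1 : (1 : DiffPoly δ) = 0 := eq_zero_of_mem_span_of_coeff_eq_zero hzN hzN' h fun i hi => by
      rw [← map_one (C δ), coeff_C, if_neg (by omega)]
    have := congrArg (coeff 0) h1
    rw [← map_one (C δ), coeff_C, if_pos rfl, map_zero] at this
    exact one_ne_zero this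
  have : Nontrivial (DiffPoly δ ⧸ Ideal.span {z}) := ⟨1, 0, hne⟩
  refine IsSimpleRing.of_eq_bot_or_eq_top fun T => or_iff_not_imp_left.mpr fun hT => ?_
  rw [← TwoSidedIdeal.one_mem_iff]
  let π := Ideal.Quotient.mk (Ideal.span {z})
  suffices H : ∀ m, m ≤ N → ∀ u : DiffPoly δ, (∀ i, m ≤ i → coeff i u = 0) → u ≠ 0 → π u ∈ T →
      1 ∈ T by
    obtain ⟨a, haT, ha0 : a ≠ 0⟩ := SetLike.exists_of_lt (bot_lt_iff_ne_bot.mpr hT)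
    obtain ⟨u, hu, rfl⟩ := exists_mk_eq hzN hzN' a
    exact H N le_rfl u hu (fun h => ha0 (by rw [h, map_zero])) haT
  intro m
  induction m with
  | zero => exact fun _ u hu hu0 _ => absurd (ext_coeff fun n => by simp [hu n]) hu0
  | succ m ih =>
    intro hm u hu hu0 huT
    by_cases hum : coeff m u = 0
    · refine ih (by omega) u (fun i hi => ?_) hu0 huT
      rcases hi.eq_or_lt with rfl | hi
      · exact hum
      · exact hu i hi
    set v := C δ (coeff m u)⁻¹ * u with hv
    have hvT : π v ∈ T := by rw [hv, map_mul]; exact T.mul_mem_left _ _ huT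
    have hvm : coeff m v = 1 := by rw [hv, coeff_C_mul, inv_mul_cancel₀ hum]
    have hvi : ∀ i, m < i → coeff i v = 0 := fun i hi => by
      rw [hv, coeff_C_mul, hu i hi, mul_zero]
    by_contra h1
    have hIH : ∀ w : DiffPoly δ, (∀ i, m ≤ i → coeff i w = 0) → π w ∈ T → w = 0 := by
      intro w hw hwT
      by_contra hw0
      exact h1 (ih (by omega) w hw hw0 hwT)
    have hvc : v ∈ Subring.center (DiffPoly δ) := by
      rw [mem_center_iff, ← commute_t_iff]
      constructor
      · intro a
        rw [eq_comm, ← sub_eq_zero]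
        refine hIH _ (fun i hi => ?_) ?_
        · rcases hi.eq_or_lt with rfl | hi
          · rw [(coeff_commutator_C hvi a).2, hvm, one_mul, mul_one, sub_self]
          · exact (coeff_commutator_C hvi a).1 i hi
        · rw [map_sub, map_mul _ v, map_mul _ _ v]
          exact T.sub_mem (T.mul_mem_right _ _ hvT) (T.mul_mem_left _ _ hvT)
      · rw [← sub_eq_zero]
        refine hIH _ (fun i hi => ?_) ?_
        · rw [coeff_commutator_t]
          rcases hi.eq_or_lt with rfl | hi
          · rw [hvm, δ.map_one]
          · rw [hvi i hi, map_zero]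
        · rw [map_sub, map_mul _ _ v, map_mul _ v]
          exact T.sub_mem (T.mul_mem_left _ _ hvT) (T.mul_mem_right _ _ hvT)
    have hvC := hcen v hvc fun i hi => hvi i (by omega)
    have hv0 : coeff 0 v ≠ 0 := fun h => by
      rw [hvC, h, map_zero, map_zero] at hvm
      exact zero_ne_one hvm
    apply h1
    have := T.mul_mem_left (π (C δ (coeff 0 v)⁻¹)) _ hvT
    rwa [← map_mul, hvC, coeff_C, if_pos rfl, ← map_mul, inv_mul_cancel₀ hv0, map_one,
      map_one] at this

/-- For a reduced representative of a central class, commutators with `t` and with `D` have degree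
below `N` and lie in `R z`, so they vanish already in `R`. -/
theorem isCentral_quotient
    (hzN : coeff N z = 1) (hzN' : ∀ i, N < i → coeff i z = 0)
    (hcen : ∀ u ∈ Subring.center (DiffPoly δ), (∀ i, N ≤ i → coeff i u = 0) →
      u = C δ (coeff 0 u)) :
    Algebra.IsCentral δ.constField (DiffPoly δ ⧸ Ideal.span {z}) := by
  refine ⟨fun s hs => ?_⟩
  obtain ⟨u, hu, rfl⟩ := exists_mk_eq hzN hzN' s
  obtain ⟨M, rfl⟩ | hN : (∃ M, N = M + 1) ∨ N = 0 := by
    obtain _ | M := N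
    · exact Or.inr rfl
    · exact Or.inl ⟨M, rfl⟩
  swap
  · subst hN
    rw [show u = 0 from ext_coeff fun n => by simp [hu n], map_zero]
    exact zero_mem _
  have huc : u ∈ Subring.center (DiffPoly δ) := by
    rw [mem_center_iff, ← commute_t_iff]
    rw [Subalgebra.mem_center_iff] at hs
    constructor
    · intro a
      rw [eq_comm, ← sub_eq_zero]
      refine eq_zero_of_mem_span_of_coeff_eq_zero hzN hzN' ?_
        fun i hi => (coeff_commutator_C (m := M) (fun i hi => hu i hi) a).1 i hi
      rw [← Ideal.Quotient.eq_zero_iff_mem, map_sub, map_mul, map_mul, hs, sub_self]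
    · rw [← sub_eq_zero]
      refine eq_zero_of_mem_span_of_coeff_eq_zero hzN hzN' ?_
        fun i hi => by rw [coeff_commutator_t, hu i hi, map_zero]
      rw [← Ideal.Quotient.eq_zero_iff_mem, map_sub, map_mul, map_mul, hs, sub_self]
  have huC := hcen u huc hu
  rw [huC] at huc ⊢
  exact ⟨⟨_, C_mem_center_iff.mp huc⟩, rfl⟩

/-- Division by the monic `z` leaves remainders given by `N` coefficients in `D`. -/
theorem finite_quotient
    (hzN : coeff N z = 1) (hzN' : ∀ i, N < i → coeff i z = 0) [Module.Finite δ.constField D] :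
    Module.Finite δ.constField (DiffPoly δ ⧸ Ideal.span {z}) := by
  let ψ : (Fin N → D) →ₗ[δ.constField] DiffPoly δ :=
    { toFun := fun v => ∑ i : Fin N, C δ (v i) * t δ ^ (i : ℕ)
      map_add' := fun v w => by
        rw [← Finset.sum_add_distrib]
        exact Finset.sum_congr rfl fun i _ => by rw [Pi.add_apply, map_add, add_mul]
      map_smul' := fun a v => by
        rw [RingHom.id_apply, Finset.smul_sum]
        refine Finset.sum_congr rfl fun i _ => ?_
        rw [smul_eq, ← mul_assoc, ← map_mul]
        rfl }
  refine Module.Finite.of_surjective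
    ((Ideal.Quotient.mkₐ δ.constField (Ideal.span {z})).toLinearMap ∘ₗ ψ) fun s => ?_
  obtain ⟨u, hu, rfl⟩ := exists_mk_eq hzN hzN' s
  refine ⟨fun i => coeff i u, ?_⟩
  conv_rhs => rw [eq_sum_range hu]
  rw [← Fin.sum_univ_eq_sum_range (fun i => C δ (coeff i u) * t δ ^ i)]
  rfl

end Quotient

end DiffPoly

/-! ### Finiteness of `D` over `F` -/

namespace RingDerivation

/-- If a derivation of a field `K` satisfies a monic linear differential equation on all of `K`,
then `K` is spanned by finitely many elements over the field of constants. -/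
theorem exists_finite_spanning_of_linear_recurrence {K : Type*} [Field K] (d : RingDerivation K)
    {N : ℕ} (hN : 0 < N) (r : Fin N → K) (hr : ∀ a, (d^[N]) a = ∑ i : Fin N, r i * (d^[i]) a) :
    ∃ (n : ℕ) (y : Fin n → K), ∀ a, ∃ x : Fin n → K, (∀ j, d (x j) = 0) ∧ a = ∑ j, x j * y j := by
  -- Jets of solutions: the equation becomes the first-order system `d v = T v`, with `T` the
  -- `K`-linear companion map.
  let v : K → Fin N → K := fun a i => (d^[i]) a
  let T : (Fin N → K) → (Fin N → K) := fun w i =>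
    if h : (i : ℕ) + 1 < N then w ⟨i + 1, h⟩ else ∑ j, r j * w j
  have hT : ∀ (n : ℕ) (x : Fin n → K) (w : Fin n → Fin N → K),
      T (∑ j, x j • w j) = ∑ j, x j • T (w j) := by
    intro n x w
    funext i
    simp only [T, Finset.sum_apply, Pi.smul_apply, smul_eq_mul]
    split_ifs with h
    · rfl
    · simp only [Finset.mul_sum]
      rw [Finset.sum_comm]
      exact Finset.sum_congr rfl fun j _ => Finset.sum_congr rfl fun k _ => by ring
  have hv : ∀ a i, d (v a i) = T (v a) i := by
    intro a i
    simp only [T, v]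
    rw [← Function.iterate_succ_apply' (f := d)]
    split_ifs with h
    · rfl
    · rw [← hr, show (i : ℕ).succ = N by omega]
  obtain ⟨b, hbs, hspan, hli⟩ := exists_linearIndependent K (Set.range v)
  have hbf : Finite b := hli.finite
  obtain ⟨n, ⟨ε⟩⟩ := Finite.exists_equiv_fin b
  choose y hy using fun j => hbs (ε.symm j).2
  have hli' : LinearIndependent K fun j => v (y j) := by
    rw [show (fun j => v (y j)) = Subtype.val ∘ ε.symm from funext hy]
    exact hli.comp ε.symm ε.symm.injective
  have hspan' : ∀ a, v a ∈ Submodule.span K (Set.range fun j => v (y j)) := by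
    intro a
    have h1 : v a ∈ Submodule.span K b := by
      rw [hspan]; exact Submodule.subset_span ⟨a, rfl⟩
    refine Submodule.span_mono ?_ h1
    intro w hw
    exact ⟨ε ⟨w, hw⟩, by simp [hy]⟩
  refine ⟨n, y, fun a => ?_⟩
  obtain ⟨x, hx⟩ := (Submodule.mem_span_range_iff_exists_fun K).mp (hspan' a)
  refine ⟨x, ?_, ?_⟩
  · have h0 : ∑ j, d (x j) • v (y j) = 0 := by
      funext i
      have h1 := hv a i
      rw [← hx, hT] at h1
      simp only [Finset.sum_apply, Pi.smul_apply, smul_eq_mul, map_sum, d.leibniz, hv,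
        Finset.sum_add_distrib] at h1
      simpa using h1
    exact Fintype.linearIndependent_iff.mp hli' _ h0
  · have := congrFun hx ⟨0, hN⟩
    simp only [Finset.sum_apply, Pi.smul_apply, smul_eq_mul] at this
    exact this.symm

variable {D : Type*} [DivisionRing D] (δ : RingDerivation D)

theorem map_mem_center {a : D} (ha : a ∈ Subring.center D) : δ a ∈ Subring.center D := by
  rw [Subring.mem_center_iff] at ha ⊢
  intro x
  have h := congrArg δ (ha x)
  rw [δ.leibniz, δ.leibniz, ha] at h
  rw [add_comm] at h
  exact (add_left_cancel h)

/-- The restriction of a derivation to the center. -/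
def restrictCenter : RingDerivation (Subring.center D) where
  toFun a := ⟨δ a, δ.map_mem_center a.2⟩
  map_zero' := Subtype.ext (map_zero δ)
  map_add' a b := Subtype.ext (map_add δ (a : D) b)
  leibniz' a b := Subtype.ext (δ.leibniz a b)

theorem coe_restrictCenter_iterate (n : ℕ) (a : Subring.center D) :
    ((δ.restrictCenter^[n] a : Subring.center D) : D) = (δ^[n]) (a : D) := by
  induction n with
  | zero => rfl
  | succ n ih =>
    rw [Function.iterate_succ_apply', Function.iterate_succ_apply', ← ih]
    rfl

/-- If `D` is finite over its center and `g(δ)` is inner for some monic nonconstant `g` over the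
field `F` of central constants, then `D` is finite over `F`. -/
theorem finite_of_isInnerBy [Module.Finite (Subring.center D) D] {g : (δ.constField)[X]}
    (hg : g.Monic) (hd : 0 < g.natDegree) {c : D} (hc : IsInnerBy (aeval δ.toEnd g) c) :
    Module.Finite δ.constField D := by
  have hle : δ.constField.toSubring ≤ Subring.center D := fun a ha => ha.1
  let ι : δ.constField →+* Subring.center D := Subring.inclusion hle
  let _ : Algebra δ.constField (Subring.center D) := ι.toAlgebra
  have : IsScalarTower δ.constField (Subring.center D) D :=
    ⟨fun a x d => mul_assoc (a : D) x d⟩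
  -- An inner derivation kills the centre, so `g(δ) = 0` there: a monic linear equation for `δ` on
  -- the centre, whose field of constants is `F`.
  obtain ⟨n, y, hy⟩ := exists_finite_spanning_of_linear_recurrence δ.restrictCenter hd
    (fun i => -ι (g.coeff i)) (by
      intro a
      have h := hc a
      rw [← Subring.mem_center_iff.mp a.2 c, sub_self, δ.aeval_toEnd_apply (Nat.lt_succ_self _),
        Finset.sum_range_succ, hg.coeff_natDegree, OneMemClass.coe_one, one_mul] at h
      apply Subtype.ext
      rw [coe_restrictCenter_iterate, eq_neg_of_add_eq_zero_right h, AddSubmonoidClass.coe_finsetSum,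
        ← Fin.sum_univ_eq_sum_range (fun i => (g.coeff i : D) * (δ^[i]) (a : D)),
        ← Finset.sum_neg_distrib]
      refine Finset.sum_congr rfl fun i _ => ?_
      rw [Subring.coe_mul, coe_restrictCenter_iterate, Subring.coe_neg, neg_mul]
      rfl)
  have : Module.Finite δ.constField (Subring.center D) := by
    refine Module.Finite.of_surjective (Fintype.linearCombination δ.constField y) fun a => ?_
    obtain ⟨x, hx, hax⟩ := hy a
    refine ⟨fun j => ⟨x j, (x j).2, congrArg Subtype.val (hx j)⟩, ?_⟩
    rw [Fintype.linearCombination_apply, hax]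
    rfl
  exact Module.Finite.trans (Subring.center D) D

end RingDerivation

/-! ### Degrees of central multiples, and the theorem -/

namespace DiffPoly

variable {D : Type*} [DivisionRing D] {δ : RingDerivation D}

theorem coeff_pow_of_monic {z : DiffPoly δ} {N : ℕ} (hzN : coeff N z = 1)
    (hzN' : ∀ i, N < i → coeff i z = 0) (k : ℕ) :
    coeff (k * N) (z ^ k) = 1 ∧ ∀ i, k * N < i → coeff i (z ^ k) = 0 := by
  induction k with
  | zero =>
    rw [pow_zero, Nat.zero_mul, ← map_one (C δ)]
    exact ⟨by rw [coeff_C, if_pos rfl], fun i hi => by rw [coeff_C, if_neg (by omega)]⟩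
  | succ k ih =>
    rw [pow_succ, Nat.succ_mul]
    exact ⟨by rw [coeff_mul_add ih.2 hzN', ih.1, hzN, one_mul],
      fun i hi => coeff_mul_of_lt ih.2 hzN' hi⟩

theorem degree_aeval_of_monic {z : DiffPoly δ} {N : ℕ} (hN : 0 < N) (hzN : coeff N z = 1)
    (hzN' : ∀ i, N < i → coeff i z = 0) {q : (δ.constField)[X]} (hq : q.Monic) :
    degree (aeval z q) = (q.natDegree * N : ℕ) := by
  have hlt : ∀ i j, i < q.natDegree → q.natDegree * N ≤ j →
      coeff j (q.coeff i • z ^ i) = 0 := by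
    intro i j hi hj
    rw [coeff_smul, (coeff_pow_of_monic hzN hzN' i).2 j, mul_zero]
    exact (Nat.mul_lt_mul_of_pos_right hi hN).trans_le hj
  rw [aeval_eq_sum_range, Finset.sum_range_succ, hq.coeff_natDegree, one_smul]
  refine degree_eq_of_coeff ?_ fun j hj => ?_
  · rw [map_add, map_sum, Finset.sum_eq_zero fun i hi => hlt i _ (Finset.mem_range.mp hi) le_rfl,
      zero_add, (coeff_pow_of_monic hzN hzN' _).1]
    exact one_ne_zero
  · rw [map_add, map_sum, Finset.sum_eq_zero fun i hi => hlt i _ (Finset.mem_range.mp hi) hj.le,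
      zero_add, (coeff_pow_of_monic hzN hzN' _).2 j hj]

/-- If the eigenring of `f` is central over `F`, every central element of `D[t; δ]` is congruent
to an element of `F` modulo the left ideal generated by `f`. -/
theorem exists_rightDvd_sub_of_isCentral {f z : DiffPoly δ}
    (hz : z ∈ Subring.center (DiffPoly δ))
    (hf : Algebra.IsCentral δ.constField (Eigenring δ.constField f)) :
    ∃ b : δ.constField, f ∣ᵣ z - C δ (b : D) := by
  have hzc := Subring.mem_center_iff.mp hz
  -- Centrality gives `f * z = z * f`, so `z` lies in the idealiser.
  let x : idealiser δ.constField f := ⟨z, ⟨z, hzc f⟩⟩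
  have hx : Ideal.Quotient.mk (idealiserIdeal δ.constField f) x ∈
      Subalgebra.center δ.constField (Eigenring δ.constField f) := by
    rw [Subalgebra.mem_center_iff]
    intro y
    obtain ⟨y, rfl⟩ := Ideal.Quotient.mk_surjective y
    rw [← map_mul, ← map_mul]
    congr 1
    exact Subtype.ext (hzc y)
  obtain ⟨b, hb⟩ := hf.out hx
  exact ⟨b, (Ideal.Quotient.eq (I := idealiserIdeal δ.constField f) (x := x)
    (y := algebraMap _ _ b)).mp hb.symm⟩

end DiffPoly

theorem theorem4 {D : Type*} [DivisionRing D] [Module.Finite (Subring.center D) D]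
    (p : ℕ) [Fact p.Prime] [CharP (Subring.center D) p]
    (δ : RingDerivation D) (g : (δ.constField)[X]) (e : ℕ)
    (hg : IsMinPPolynomial p δ g) (hge : g.natDegree = p ^ e)
    (c : D) (hc : IsInnerBy (aeval δ.toEnd g) c) (hδc : δ c = 0)
    (f : DiffPoly δ) (hhat : (δ.constField)[X]) (hmonic : hhat.Monic)
    (hmin : IsMinimalCentralLeftMultiple f
      (aeval (aeval (DiffPoly.t δ) g - DiffPoly.C δ c) hhat))
    (hirr : Irreducible hhat) :
    (IsGeneralisedAPolynomial f ↔
      ∃ b : δ.constField,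
        f ∣ᵣ aeval (DiffPoly.t δ) g - DiffPoly.C δ ((b : D) + c)) ∧
    (IsGeneralisedAPolynomial f → f.degree ≤ ((p ^ e : ℕ) : WithBot ℕ)) := by
  obtain ⟨hgm, hgp, -, hgmin⟩ := hg
  have : CharP D p := charP_of_injective_ringHom (Subring.center D).subtype_injective p
  have hN0 : 0 < p ^ e := pow_pos (Fact.out : p.Prime).pos e
  have hz : ∀ b : D, DiffPoly.coeff (p ^ e) (aeval (DiffPoly.t δ) g - DiffPoly.C δ b) = 1 ∧
      ∀ i, p ^ e < i → DiffPoly.coeff i (aeval (DiffPoly.t δ) g - DiffPoly.C δ b) = 0 := by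
    intro b
    constructor
    · rw [map_sub, DiffPoly.coeff_aeval_t, DiffPoly.coeff_C, if_neg hN0.ne', sub_zero, ← hge,
        hgm.coeff_natDegree]
      rfl
    · intro i hi
      rw [map_sub, DiffPoly.coeff_aeval_t, DiffPoly.coeff_C, if_neg (hN0.trans hi).ne', sub_zero,
        Polynomial.coeff_eq_zero_of_natDegree_lt (by omega)]
      rfl
  have hzc := DiffPoly.aeval_t_sub_C_mem_center hgp hc hδc
  have hsplit : ∀ b : δ.constField, aeval (DiffPoly.t δ) g - DiffPoly.C δ ((b : D) + c) =
      aeval (DiffPoly.t δ) g - DiffPoly.C δ c - DiffPoly.C δ (b : D) := by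
    intro b
    rw [map_add]
    abel
  have hforward : IsGeneralisedAPolynomial f → ∃ b : δ.constField,
      f ∣ᵣ aeval (DiffPoly.t δ) g - DiffPoly.C δ ((b : D) + c) := by
    intro hf
    obtain ⟨b, hb⟩ := DiffPoly.exists_rightDvd_sub_of_isCentral hzc hf.2.1
    exact ⟨b, by rwa [hsplit]⟩
  refine ⟨⟨hforward, ?_⟩, ?_⟩
  · rintro ⟨b, hb⟩
    set z := aeval (DiffPoly.t δ) g - DiffPoly.C δ ((b : D) + c) with hzdef
    have hzb : z ∈ Subring.center (DiffPoly δ) := by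
      rw [hzdef, hsplit b]
      exact sub_mem hzc (DiffPoly.C_mem_center_iff.mpr b.2)
    have hz1 := (hz ((b : D) + c)).1
    have hz2 := (hz ((b : D) + c)).2
    rw [← hzdef] at hz1 hz2
    have hcen : ∀ u ∈ Subring.center (DiffPoly δ),
        (∀ i, p ^ e ≤ i → DiffPoly.coeff i u = 0) → u = DiffPoly.C δ (DiffPoly.coeff 0 u) :=
      fun u hu h => DiffPoly.eq_C_of_mem_center (p := p) (fun g' h1 h2 h3 => hge ▸ hgmin g' h1 h2 h3)
        hu h
    have hfD : Module.Finite δ.constField D := δ.finite_of_isInnerBy hgm (hge ▸ hN0) hc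
    have := DiffPoly.isTwoSided_span_of_mem_center hzb
    have := DiffPoly.isSimpleRing_quotient hN0 hz1 hz2 hcen
    have := DiffPoly.isCentral_quotient hz1 hz2 hcen
    have hfin := DiffPoly.finite_quotient hz1 hz2
    have : IsArtinianRing (DiffPoly δ ⧸ Ideal.span {z}) := IsArtinianRing.of_finite δ.constField _
    have : IsSemisimpleRing (DiffPoly δ ⧸ Ideal.span {z}) :=
      IsSimpleRing.isSemisimpleRing_iff_isArtinianRing.mpr this
    have hker : ∀ q, Ideal.Quotient.mkₐ δ.constField (Ideal.span {z}) q = 0 → f ∣ᵣ q := by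
      intro q hq
      obtain ⟨s, rfl⟩ := Ideal.mem_span_singleton'.mp (Ideal.Quotient.eq_zero_iff_mem.mp hq)
      exact hb.mul_left s
    -- Otherwise `1` would be a central left multiple of `f` of degree smaller than `deg ĥ * p ^ e >
    -- 0`.
    have hf1 : ¬ f ∣ᵣ 1 := by
      intro h1
      have hle := hmin.2.2.2 1 one_ne_zero (one_mem _) h1
      rw [DiffPoly.degree_aeval_of_monic hN0 (hz c).1 (hz c).2 hmonic] at hle
      have h2 : DiffPoly.degree (1 : DiffPoly δ) = (0 : ℕ) := Polynomial.degree_one (R := D)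
      rw [h2, Nat.cast_le] at hle
      have := Nat.mul_pos hirr.natDegree_pos hN0
      omega
    exact eigenring_isSimpleRing_isCentral_finite _
      (Ideal.Quotient.mkₐ_surjective δ.constField (Ideal.span {z})) f hker hf1
  · intro hf
    obtain ⟨b, q, hq⟩ := hforward hf
    have hd : DiffPoly.degree (aeval (DiffPoly.t δ) g - DiffPoly.C δ ((b : D) + c)) =
        (p ^ e : ℕ) :=
      DiffPoly.degree_eq_of_coeff (by rw [(hz _).1]; exact one_ne_zero) (hz _).2
    rw [← hd, hq, DiffPoly.degree_mul]
    have hq0 : q ≠ 0 := by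
      rintro rfl
      rw [hq, zero_mul] at hd
      rw [DiffPoly.degree_eq_bot_iff.mpr rfl] at hd
      exact WithBot.bot_ne_coe hd
    obtain ⟨n, hn, -⟩ := DiffPoly.exists_degree_eq hq0
    rw [hn]
    exact le_add_of_nonneg_left (Nat.cast_nonneg n)

end
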